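/- Let $\mathbf X$ be an arbitrary set and let $\mathcal F$ be a (real) reproducing kernel Hilbert space of functions on $\mathbf X$ with reproducing kernel $K:\mathbf X^2\to\mathbb R$. Let $d\ge 1$ and $a>0$. Outcomes are vectors $y=(y^1,\dots,y^d)$ in the probability simplex of $\mathbb R^d$, and the loss of a prediction $\gamma\in\mathbb R^d$ is the Brier loss $\lambda(y,\gamma)=\sum_{i=1}^d(\gamma^i-y^i)^2$. For inputs $x_1,\dots,x_t\in\mathbf X$ let $\widetilde K_t=(K(x_s,x_u))_{s,u=1}^t$, $\widetilde k_t=(K(x_1,x_t),\dots,K(x_t,x_t))'$, and let $$A_t=aI+\begin{pmatrix}2\widetilde K_t&\cdots&\widetilde K_t\\ \vdots&\ddots&\vdots\\ \widetilde K_t&\cdots&2\widetilde K_t\end{pmatrix}$$ be the $(d-1)t\times(d-1)t$ matrix with $(d-1)\times(d-1)$ blocks, where the diagonal blocks of the second summand are $2\widetilde K_t$ and its other blocks are $\widetilde K_t$. The algorithm mKAAR with parameter $a$ works as follows. At step $t$, having seen $x_1,\dots,x_t$ and $y_1,\dots,y_{t-1}$, put, for $j=1,\dots,d-1$, $$\widetilde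 Y_j=-2\,(y_1^j-y_1^d,\dots,y_{t-1}^j-y_{t-1}^d,-\tfrac12),\qquad \overline Y_j=-2\,(y_1^j-y_1^d,\dots,y_{t-1}^j-y_{t-1}^d,0),$$ compute $r_d=0$ and, for $i=1,\dots,d-1$, $$r_i=\begin{pmatrix}\widetilde Y_1&\cdots&\overline Y_i&\cdots&\widetilde Y_{d-1}\end{pmatrix}A_t^{-1}\begin{pmatrix}\widetilde k_t'&\cdots&2\widetilde k_t'&\cdots&\widetilde k_t'\end{pmatrix}'$$ (with $\overline Y_i$ and $2\widetilde k_t'$ in the $i$-th block), find the unique $s\in\mathbb R$ with $\sum_{i=1}^d(s-r_i)^+=2$, where $u^+=\max(u,0)$, and predict $\gamma_t$ with $\gamma_t^i=(s-r_i)^+/2$ for $i=1,\dots,d$. Let $L_T(\mathrm{mKAAR})=\sum_{t=1}^T\lambda(y_t,\gamma_t)$. For $f=(f_1,\dots,f_{d-1})\in\mathcal F^{d-1}$ let $L_T(f)=\sum_{t=1}^T\lambda(y_t,\xi_t)$, where $\xi_t^i=1/d+f_i(x_t)$ for $i=1,\dots,d-1$ and $\xi_t^d=1-\xi_t^1-\cdots-\xi_t^{d-1}$.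 Then for any $a>0$, any $f_1,\dots,f_{d-1}\in\mathcal F$, any positive integer $T$, and any sequence of inputs and outcomes $(x_1,y_1),\dots,(x_T,y_T)$, $$L_T(\mathrm{mKAAR})\le L_T(f)+a\sum_{i=1}^{d-1}\|f_i\|_{\mathcal F}^2+\frac12\ln\det\left(\frac1a A_T\right).$$ -/

import Mathlib

/-! Outcomes and predictions have `d = m + 1` components, indexed by `Fin (m + 1)`; the last
component `Fin.last m` plays the role of the remainder. Trials are numbered from `0`. -/

/-- The Brier loss `λ(y, γ) = ∑ σ, (γ σ - y σ)²`. -/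
def brierLoss {m : ℕ} (y γ : Fin (m + 1) → ℝ) : ℝ :=
  ∑ σ, (γ σ - y σ) ^ 2

/-- The real-valued reproducing kernel of a reproducing kernel Hilbert space of real functions.
(Mathlib's kernel takes values in the linear maps `ℝ →L[ℝ] ℝ`, identified here with `ℝ`.) -/
noncomputable def scalarKernel {X : Type*} (F : Type*) [NormedAddCommGroup F]
    [InnerProductSpace ℝ F] [CompleteSpace F] [RKHS ℝ F X ℝ] (x y : X) : ℝ :=
  RKHS.kernel F x y 1

/-- The matrix `a I + (2K̃ ⋯ K̃; ⋮ ⋱ ⋮; K̃ ⋯ 2K̃)` with `m × m` blocks, where `K̃` is the `n × n`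
matrix of the kernel values `K (x s) (x u)`. The index `(i, s)` is row `s` of block row `i`. -/
noncomputable def blockGram {X : Type*} (K : X → X → ℝ) (a : ℝ) (m : ℕ) {n : ℕ} (x : Fin n → X) :
    Matrix (Fin m × Fin n) (Fin m × Fin n) ℝ :=
  a • (1 : Matrix (Fin m × Fin n) (Fin m × Fin n) ℝ) +
    Matrix.of fun p q => (if p.1 = q.1 then 2 else 1) * K (x p.2) (x q.2)

/-- The vector `-2 (y₁ʲ - y₁ᵈ, …, yₜʲ - yₜᵈ, c)` formed from `t` past outcomes. -/
noncomputable def outcomeVec {m t : ℕ} (y : Fin t → Fin (m + 1) → ℝ) (c : ℝ) (j : Fin m) :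
    Fin (t + 1) → ℝ :=
  fun s => -2 * Fin.snoc (α := fun _ => ℝ)
    (fun u : Fin t => y u j.castSucc - y u (Fin.last m)) c s

/-- The numbers `r₁, …, r_{d-1}, r_d = 0` computed by mKAAR from the inputs seen so far (the
current one is the last) and the past outcomes: for `i < d`,
`r_i = (Ỹ₁ ⋯ Ȳ_i ⋯ Ỹ_{d-1}) A⁻¹ (k̃' ⋯ 2k̃' ⋯ k̃')'`. -/
noncomputable def mkaarScore {X : Type*} (K : X → X → ℝ) (a : ℝ) {m t : ℕ}
    (x : Fin (t + 1) → X) (y : Fin t → Fin (m + 1) → ℝ) : Fin (m + 1) → ℝ :=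
  Fin.snoc (α := fun _ => ℝ)
    (fun i : Fin m =>
      (fun p : Fin m × Fin (t + 1) => outcomeVec y (if p.1 = i then 0 else -1 / 2) p.1 p.2) ⬝ᵥ
        ((blockGram K a m x)⁻¹.mulVec fun p =>
          (if p.1 = i then 2 else 1) * K (x p.2) (x (Fin.last t))))
    0

/-- The equation `∑ i, (s - r i)⁺ = 2` has exactly one solution `s`. -/
theorem existsUnique_threshold {m : ℕ} (r : Fin (m + 1) → ℝ) :
    ∃! s : ℝ, ∑ i, max (s - r i) 0 = 2 := by
  have hle : ∀ i, (⨅ j, r j) ≤ r i := fun i => ciInf_le (Set.finite_range r).bddBelow i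
  have hcont : Continuous fun s : ℝ => ∑ i, max (s - r i) 0 := by fun_prop
  have hlow : ∑ i, max ((⨅ j, r j) - r i) 0 = 0 :=
    Finset.sum_eq_zero fun i _ => max_eq_right (by linarith [hle i])
  have hhigh : 2 ≤ ∑ i, max (r 0 + 2 - r i) 0 := by
    have h := Finset.single_le_sum (f := fun i => max (r 0 + 2 - r i) 0)
      (fun i _ => le_max_right _ _) (Finset.mem_univ 0)
    refine le_trans ?_ h
    exact le_max_of_le_left (by linarith)
  obtain ⟨s, -, hs⟩ := intermediate_value_Icc (by linarith [hle 0] : (⨅ j, r j) ≤ r 0 + 2)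
    hcont.continuousOn (show (2 : ℝ) ∈ Set.Icc _ _ from ⟨by rw [hlow]; norm_num, hhigh⟩)
  have key : ∀ u v : ℝ, ∑ i, max (u - r i) 0 = 2 → u < v →
      (2 : ℝ) < ∑ i, max (v - r i) 0 := by
    intro u v hu huv
    rw [← hu]
    refine Finset.sum_lt_sum (fun i _ => max_le_max_right 0 (by linarith)) ?_
    by_contra! hcon
    have h0 : ∑ i, max (u - r i) 0 = 0 := Finset.sum_eq_zero fun i hi => by
      have h1 := hcon i hi
      rcases le_total (u - r i) 0 with h | h
      · exact max_eq_right h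
      · rw [max_eq_left h, max_eq_left (by linarith)] at h1
        linarith
    linarith
  refine ⟨s, hs, fun v hv => ?_⟩
  have hs' : ∑ i, max (s - r i) 0 = 2 := hs
  have hv' : ∑ i, max (v - r i) 0 = 2 := hv
  rcases lt_trichotomy v s with h | h | h
  · linarith [key v s hv' h]
  · exact h
  · linarith [key s v hs' h]

/-- The solution `s` of `∑ i, (s - r i)⁺ = 2`. -/
noncomputable def threshold {m : ℕ} (r : Fin (m + 1) → ℝ) : ℝ :=
  (existsUnique_threshold r).choose

/-- The substitution function `γ i = (s - r i)⁺ / 2`, where `∑ i, (s - r i)⁺ = 2`. -/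
noncomputable def substitution {m : ℕ} (r : Fin (m + 1) → ℝ) : Fin (m + 1) → ℝ :=
  fun i => max (threshold r - r i) 0 / 2

/-- The prediction of mKAAR with kernel `K` and parameter `a`, given the inputs up to and including
the current one, and the outcomes of the previous trials. -/
noncomputable def mkaarPredict {X : Type*} (K : X → X → ℝ) (a : ℝ) {m t : ℕ}
    (x : Fin (t + 1) → X) (y : Fin t → Fin (m + 1) → ℝ) : Fin (m + 1) → ℝ :=
  substitution (mkaarScore K a x y)

/-- The cumulative loss of mKAAR over the first `T` trials. -/
noncomputable def mkaarLoss {X : Type*} (K : X → X → ℝ) (a : ℝ) {m : ℕ}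
    (x : ℕ → X) (y : ℕ → Fin (m + 1) → ℝ) (T : ℕ) : ℝ :=
  ∑ t ∈ Finset.range T,
    brierLoss (y t) (mkaarPredict K a (fun s : Fin (t + 1) => x s) (fun s : Fin t => y s))

/-- The prediction of the expert `(f₁, …, f_{d-1})` on the input `x`: `ξⁱ = 1/d + f_i(x)` for
`i < d` and `ξᵈ = 1 - ξ¹ - ⋯ - ξ^{d-1}`. -/
noncomputable def expertPredict {X : Type*} {m : ℕ} (f : Fin m → X → ℝ) (x : X) :
    Fin (m + 1) → ℝ :=
  Fin.snoc (α := fun _ => ℝ) (fun i => 1 / ((m : ℝ) + 1) + f i x)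
    (1 - ∑ i, (1 / ((m : ℝ) + 1) + f i x))

/-- The cumulative loss of the expert `(f₁, …, f_{d-1})` over the first `T` trials. -/
noncomputable def expertLoss {X : Type*} {m : ℕ} (f : Fin m → X → ℝ)
    (x : ℕ → X) (y : ℕ → Fin (m + 1) → ℝ) (T : ℕ) : ℝ :=
  ∑ t ∈ Finset.range T, brierLoss (y t) (expertPredict f (x t))

/-! Put d = m + 1 and B = I + 11ᵀ, and let z be the first m coordinates of y minus 1/d. On vectors
with coordinate sum 1 the Brier loss is the quadratic form of B, and an expert predicts z by f(x).
Dividing the kernel by a reduces the algorithm to parameter 1. The least regularized loss of an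
expert is then zᵀD⁻¹z with D = B⁻¹ ⊗ I + I ⊗ K/a, where K is the Gram matrix; only the weak half of
this duality is needed (`ridgeLoss_le_expert`).

By a Schur complement, a new trial adds (z - μ)ᵀW⁻¹(z - μ) to this value, with W ≥ B⁻¹, and
multiplies det(A/a) by det B · det W (`exists_ridgeLoss_snoc`). So it suffices to bound the loss of
each trial by (z - μ)ᵀW⁻¹(z - μ) + ½ ln det(BW), and to sum.

Up to a common constant, the scores are these bounds at the vertices of the simplex
(`mkaarScore_eq_ridgeLoss_sub`). The substitution function meets all of them once the Bayes loss 1 -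
∑ γᵢ² of each γ is at most the γ-average of the bounds. That holds because a random vertex has
covariance at most ½B⁻¹, so that the deficit is at most ½ tr((B - W⁻¹)B⁻¹) = ½(m - tr(W⁻¹B⁻¹)) ≤ ½
ln det(BW) (`one_sub_sum_sq_le_sum_weighted`). Since W⁻¹ ≤ B, loss minus bound is convex in y, and
the vertices suffice (`brierLoss_le_of_single`). -/

open Matrix

/-! ### Quadratic forms, log-determinants and Schur complements. -/

section Matrices

variable {n ι κ : Type*} [Fintype n] [Fintype ι] [Fintype κ]

/-- The parallel axis theorem for a quadratic form. -/
theorem sum_weighted_quadForm_sub (M : Matrix n n ℝ) (w : ι → ℝ) (hw : ∑ i, w i = 1)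
    (u : ι → n → ℝ) (b c : n → ℝ) (hb : ∑ i, w i • u i = b) :
    ∑ i, w i * ((u i - c) ⬝ᵥ M *ᵥ (u i - c)) =
      (b - c) ⬝ᵥ M *ᵥ (b - c) + ∑ i, w i * ((u i - b) ⬝ᵥ M *ᵥ (u i - b)) := by
  have h0 : ∑ i, w i • (u i - b) = 0 := by
    simp only [smul_sub, Finset.sum_sub_distrib, hb, ← Finset.sum_smul, hw, one_smul, sub_self]
  have h1 : ∑ i, w i * ((u i - b) ⬝ᵥ M *ᵥ (b - c)) = 0 := by
    simp_rw [← smul_eq_mul, ← smul_dotProduct, ← sum_dotProduct, h0, zero_dotProduct]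
  have h2 : ∑ i, w i * ((b - c) ⬝ᵥ M *ᵥ (u i - b)) = 0 := by
    simp_rw [← smul_eq_mul, ← dotProduct_smul, ← mulVec_smul, ← dotProduct_sum,
      ← mulVec_sum, h0, mulVec_zero, dotProduct_zero]
  have h3 : ∀ i, w i * ((u i - c) ⬝ᵥ M *ᵥ (u i - c)) =
      w i * ((b - c) ⬝ᵥ M *ᵥ (b - c)) + w i * ((u i - b) ⬝ᵥ M *ᵥ (u i - b)) +
        w i * ((u i - b) ⬝ᵥ M *ᵥ (b - c)) + w i * ((b - c) ⬝ᵥ M *ᵥ (u i - b)) := by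
    intro i
    have : u i - c = (u i - b) + (b - c) := by abel
    rw [this]
    simp only [mulVec_add, dotProduct_add, add_dotProduct]
    ring
  simp_rw [h3, Finset.sum_add_distrib, h1, h2, ← Finset.sum_mul, hw]
  ring

/-- The Fenchel inequality for a positive definite quadratic form. -/
theorem Matrix.PosDef.two_mul_dotProduct_sub_le [DecidableEq n] {M : Matrix n n ℝ}
    (hM : M.PosDef) (u w : n → ℝ) : 2 * (u ⬝ᵥ w) - w ⬝ᵥ M⁻¹ *ᵥ w ≤ u ⬝ᵥ M *ᵥ u := by
  have h := hM.posSemidef.dotProduct_mulVec_nonneg (u - M⁻¹ *ᵥ w)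
  have hdet : IsUnit M.det := (isUnit_iff_isUnit_det M).1 hM.isUnit
  have hMw : M *ᵥ (M⁻¹ *ᵥ w) = w := by
    rw [mulVec_mulVec, mul_nonsing_inv _ hdet, one_mulVec]
  have hsym : (M⁻¹ *ᵥ w) ⬝ᵥ M *ᵥ u = u ⬝ᵥ w := by
    have hT : Mᵀ = M := hM.isHermitian
    rw [dotProduct_mulVec, ← mulVec_transpose, hT, hMw, dotProduct_comm]
  simp only [star_trivial, mulVec_sub, dotProduct_sub, sub_dotProduct, hMw, hsym] at h
  rw [dotProduct_comm (M⁻¹ *ᵥ w) w] at h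
  linarith

/-- This is ln x ≤ x - 1 summed over the eigenvalues of `M⁻¹`. -/
theorem Matrix.PosDef.card_sub_trace_inv_le_log_det [DecidableEq n] {M : Matrix n n ℝ}
    (hM : M.PosDef) : Fintype.card n - (M⁻¹).trace ≤ Real.log M.det := by
  have hN := hM.inv
  have h1 : Real.log (M⁻¹).det ≤ (M⁻¹).trace - Fintype.card n := by
    have hd := hN.isHermitian.det_eq_prod_eigenvalues
    have ht := hN.isHermitian.trace_eq_sum_eigenvalues
    simp only [RCLike.ofReal_real_eq_id, id] at hd ht
    rw [hd, ht, Real.log_prod (fun i _ => (hN.eigenvalues_pos i).ne')]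
    calc _ ≤ ∑ i, (hN.isHermitian.eigenvalues i - 1) :=
          Finset.sum_le_sum fun i _ => Real.log_le_sub_one_of_pos (hN.eigenvalues_pos i)
      _ = _ := by simp
  rw [det_nonsing_inv, Ring.inverse_eq_inv', Real.log_inv] at h1
  linarith

/-- The bound `card_sub_trace_inv_le_log_det` for a product of positive definite matrices. -/
theorem Matrix.PosDef.card_sub_trace_le_log_det_mul [DecidableEq n] {M N : Matrix n n ℝ}
    (hM : M.PosDef) (hN : N.PosDef) :
    Fintype.card n - (N⁻¹ * M⁻¹).trace ≤ Real.log (M.det * N.det) := by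
  obtain ⟨G, rfl⟩ : ∃ G : Matrix n n ℝ, M = Gᴴ * G := by
    open scoped MatrixOrder in
    simpa [star_eq_conjTranspose] using
      (CStarAlgebra.nonneg_iff_eq_star_mul_self (a := M)).1 hM.posSemidef.nonneg
  have hG : IsUnit G.det := by
    have := (isUnit_iff_isUnit_det _).1 hM.isUnit
    rw [det_mul] at this
    exact isUnit_of_mul_isUnit_right this
  -- The product of two positive definite matrices need not be symmetric; this congruent of `N` is,
  -- with the same determinant and trace of the inverse as the product.
  have hP : (G * N * Gᴴ).PosDef := by
    have := (IsUnit.posDef_star_right_conjugate_iff (U := G) (x := N)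
      ((isUnit_iff_isUnit_det _).2 hG)).2 hN
    simpa [star_eq_conjTranspose] using this
  have h := hP.card_sub_trace_inv_le_log_det
  have h1 : (G * N * Gᴴ).det = (Gᴴ * G).det * N.det := by
    simp only [det_mul]; ring
  have h2 : ((G * N * Gᴴ)⁻¹).trace = (N⁻¹ * (Gᴴ * G)⁻¹).trace := by
    rw [mul_inv_rev, mul_inv_rev, mul_inv_rev, ← Matrix.mul_assoc N⁻¹, trace_mul_comm,
      Matrix.mul_assoc]
  rwa [h1, h2] at h

/-- Keeping only the diagonal of ∑ wᵢwⱼ(cᵢ + cⱼ)² bounds the variance by ∑ 2wᵢ(1 - wᵢ)cᵢ², and 2w(1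
- w) ≤ 1/2. This constant becomes the factor ½ of the log-determinant. -/
theorem sum_weighted_sq_sub_mean_le (w : ι → ℝ) (hw0 : ∀ i, 0 ≤ w i) (hw : ∑ i, w i = 1)
    (c : ι → ℝ) :
    ∑ i, w i * (c i - ∑ j, w j * c j) ^ 2 ≤ 1 / 2 * ∑ i, c i ^ 2 := by
  set μ := ∑ j, w j * c j with hμ
  have h1 : ∑ i, w i * (c i - μ) ^ 2 = ∑ i, w i * c i ^ 2 - μ ^ 2 := by
    have : ∀ i, w i * (c i - μ) ^ 2 = w i * c i ^ 2 - 2 * μ * (w i * c i) + μ ^ 2 * w i :=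
      fun i => by ring
    simp_rw [this, Finset.sum_add_distrib, Finset.sum_sub_distrib, ← Finset.mul_sum, ← hμ, hw]
    ring
  have h2 : ∑ i, ∑ j, w i * w j * (c i + c j) ^ 2 = 2 * ∑ i, w i * c i ^ 2 + 2 * μ ^ 2 := by
    have : ∀ i, ∑ j, w i * w j * (c i + c j) ^ 2 =
        w i * c i ^ 2 + 2 * μ * (w i * c i) + (∑ j, w j * c j ^ 2) * w i := by
      intro i
      have : ∀ j, w i * w j * (c i + c j) ^ 2 =
          w i * c i ^ 2 * w j + 2 * (w i * c i) * (w j * c j) + w i * (w j * c j ^ 2) :=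
        fun j => by ring
      simp_rw [this, Finset.sum_add_distrib, ← Finset.mul_sum, ← hμ, hw]
      ring
    simp_rw [this, Finset.sum_add_distrib, ← Finset.mul_sum, ← hμ, hw]
    ring
  have h3 : ∑ i, w i * w i * (c i + c i) ^ 2 ≤ ∑ i, ∑ j, w i * w j * (c i + c j) ^ 2 :=
    Finset.sum_le_sum fun i _ => Finset.single_le_sum (f := fun j => w i * w j * (c i + c j) ^ 2)
      (fun j _ => mul_nonneg (mul_nonneg (hw0 i) (hw0 j)) (sq_nonneg _)) (Finset.mem_univ i)
  have h4 : ∑ i, 2 * (w i * c i ^ 2) ≤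
      ∑ i, (1 / 2 * (w i * w i * (c i + c i) ^ 2) + 1 / 2 * c i ^ 2) := by
    refine Finset.sum_le_sum fun i _ => ?_
    nlinarith [mul_nonneg (sq_nonneg (2 * w i - 1)) (sq_nonneg (c i))]
  rw [Finset.sum_add_distrib, ← Finset.mul_sum, ← Finset.mul_sum, ← Finset.mul_sum] at h4
  linarith

/-- Inverting a positive definite block matrix splits off the quadratic form of the Schur
complement. -/
theorem dotProduct_inv_fromBlocks [DecidableEq n] [DecidableEq κ] {P : Matrix n n ℝ}
    (hP : P.PosDef) (Q : Matrix n κ ℝ) (R : Matrix κ κ ℝ) (hW : (R - Qᵀ * P⁻¹ * Q).PosDef)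
    (u : n → ℝ) (v : κ → ℝ) :
    Sum.elim u v ⬝ᵥ (fromBlocks P Q Qᵀ R)⁻¹ *ᵥ Sum.elim u v =
      u ⬝ᵥ P⁻¹ *ᵥ u + (v - Qᵀ *ᵥ P⁻¹ *ᵥ u) ⬝ᵥ (R - Qᵀ * P⁻¹ * Q)⁻¹ *ᵥ
        (v - Qᵀ *ᵥ P⁻¹ *ᵥ u) := by
  set W := R - Qᵀ * P⁻¹ * Q with hWdef
  have hPd : IsUnit P.det := (isUnit_iff_isUnit_det P).1 hP.isUnit
  have hWd : IsUnit W.det := (isUnit_iff_isUnit_det W).1 hW.isUnit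
  let := P.invertibleOfIsUnitDet hPd
  have hPT : (P⁻¹)ᵀ = P⁻¹ := hP.inv.isHermitian
  have hDd : IsUnit (fromBlocks P Q Qᵀ R).det := by
    rw [det_fromBlocks₁₁, invOf_eq_nonsing_inv]
    exact hPd.mul hWd
  set μ := Qᵀ *ᵥ P⁻¹ *ᵥ u
  set b := W⁻¹ *ᵥ (v - μ)
  have hWb : W *ᵥ b = v - μ := by
    rw [mulVec_mulVec, mul_nonsing_inv _ hWd, one_mulVec]
  -- Block elimination: the second component of the solution is determined by the Schur complement,
  -- the first by back substitution.
  have hsol : fromBlocks P Q Qᵀ R *ᵥ Sum.elim (P⁻¹ *ᵥ (u - Q *ᵥ b)) b = Sum.elim u v := by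
    rw [fromBlocks_mulVec]
    congr 1
    · simp only [Sum.elim_comp_inl, Sum.elim_comp_inr]
      rw [mulVec_mulVec, mul_nonsing_inv _ hPd, one_mulVec, sub_add_cancel]
    · simp only [Sum.elim_comp_inl, Sum.elim_comp_inr]
      have : R = W + Qᵀ * P⁻¹ * Q := by rw [hWdef]; abel
      rw [this, add_mulVec, hWb, mulVec_sub, mulVec_sub]
      simp only [mulVec_mulVec, Matrix.mul_assoc, μ]
      abel
  have hinv : (fromBlocks P Q Qᵀ R)⁻¹ *ᵥ Sum.elim u v = Sum.elim (P⁻¹ *ᵥ (u - Q *ᵥ b)) b := by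
    rw [← hsol, mulVec_mulVec, nonsing_inv_mul _ hDd, one_mulVec]
  have hμb : u ⬝ᵥ P⁻¹ *ᵥ Q *ᵥ b = μ ⬝ᵥ b := by
    rw [dotProduct_mulVec, dotProduct_mulVec, ← mulVec_transpose, ← mulVec_transpose, hPT]
  rw [hinv, sumElim_dotProduct_sumElim, mulVec_sub, dotProduct_sub, hμb, sub_dotProduct]
  ring

end Matrices

/-! ### The Brier loss as a quadratic form. -/

/-- The matrix of the Brier loss in the first `m` coordinates. -/
def brierMatrix (m : ℕ) : Matrix (Fin m) (Fin m) ℝ :=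
  1 + Matrix.of fun _ _ => 1

/-- The first `m` coordinates of the deviation of `y` from the uniform prediction. -/
noncomputable def deviation {m : ℕ} (y : Fin (m + 1) → ℝ) : Fin m → ℝ :=
  fun i => y i.castSucc - 1 / ((m : ℝ) + 1)

theorem brierMatrix_mulVec {m : ℕ} (v : Fin m → ℝ) (i : Fin m) :
    (brierMatrix m *ᵥ v) i = v i + ∑ j, v j := by
  rw [brierMatrix, add_mulVec, one_mulVec]
  simp [mulVec, dotProduct]

theorem dotProduct_brierMatrix_mulVec {m : ℕ} (v : Fin m → ℝ) :
    v ⬝ᵥ brierMatrix m *ᵥ v = ∑ i, v i ^ 2 + (∑ i, v i) ^ 2 := by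
  simp only [dotProduct, brierMatrix_mulVec, mul_add, Finset.sum_add_distrib, ← Finset.sum_mul,
    sq]

theorem posDef_brierMatrix (m : ℕ) : (brierMatrix m).PosDef := by
  refine PosDef.one.add_posSemidef (PosSemidef.of_dotProduct_mulVec_nonneg ?_ fun v => ?_)
  · ext i j; simp
  · have : star v ⬝ᵥ (Matrix.of fun _ _ => (1 : ℝ)) *ᵥ v = (∑ i, v i) ^ 2 := by
      simp [dotProduct, mulVec, ← Finset.sum_mul, sq]
    rw [this]
    positivity

theorem brierMatrix_inv_mulVec {m : ℕ} (v : Fin m → ℝ) (i : Fin m) :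
    ((brierMatrix m)⁻¹ *ᵥ v) i = v i - (∑ j, v j) / ((m : ℝ) + 1) := by
  have hB : IsUnit (brierMatrix m).det :=
    (isUnit_iff_isUnit_det _).1 (posDef_brierMatrix m).isUnit
  have hm : (m : ℝ) + 1 ≠ 0 := by positivity
  have h : brierMatrix m *ᵥ (fun i => v i - (∑ j, v j) / ((m : ℝ) + 1)) = v := by
    ext i
    rw [brierMatrix_mulVec]
    simp only [Finset.sum_sub_distrib, Finset.sum_const, Finset.card_univ, Fintype.card_fin,
      nsmul_eq_mul]
    field_simp
    ring
  conv_lhs => rw [← h]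
  rw [mulVec_mulVec, nonsing_inv_mul _ hB, one_mulVec]

/-- Explains the differences yʲ - yᵈ in the algorithm: they are the image of the deviation under the
loss matrix. -/
theorem brierMatrix_mulVec_deviation {m : ℕ} {y : Fin (m + 1) → ℝ} (hy : ∑ i, y i = 1)
    (i : Fin m) :
    (brierMatrix m *ᵥ deviation y) i = y i.castSucc - y (Fin.last m) := by
  rw [Fin.sum_univ_castSucc] at hy
  have hm : (m : ℝ) + 1 ≠ 0 := by positivity
  rw [brierMatrix_mulVec]
  simp only [deviation, Finset.sum_sub_distrib, Finset.sum_const, Finset.card_univ,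
    Fintype.card_fin, nsmul_eq_mul]
  have : ∑ j : Fin m, y j.castSucc = 1 - y (Fin.last m) := by linarith
  rw [this]
  field_simp
  ring

theorem brierLoss_single {m : ℕ} (i : Fin (m + 1)) (γ : Fin (m + 1) → ℝ) :
    brierLoss (Pi.single i 1) γ = 1 - 2 * γ i + ∑ j, γ j ^ 2 := by
  have : ∀ j, (γ j - (Pi.single i 1 : Fin (m + 1) → ℝ) j) ^ 2 =
      γ j ^ 2 + (if j = i then 1 - 2 * γ i else 0) := by
    intro j
    rw [Pi.single_apply]
    split_ifs with h
    · rw [h]; ring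
    · ring
  simp only [brierLoss, this, Finset.sum_add_distrib, Finset.sum_ite_eq', Finset.mem_univ,
    if_true]
  ring

theorem brierLoss_eq_quadForm {m : ℕ} {y γ : Fin (m + 1) → ℝ} (hy : ∑ i, y i = 1)
    (hγ : ∑ i, γ i = 1) :
    brierLoss y γ =
      (deviation y - deviation γ) ⬝ᵥ brierMatrix m *ᵥ (deviation y - deviation γ) := by
  rw [dotProduct_brierMatrix_mulVec, brierLoss]
  rw [Fin.sum_univ_castSucc] at hy hγ ⊢
  have h1 : ∑ i, (deviation y - deviation γ) i = γ (Fin.last m) - y (Fin.last m) := by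
    simp only [deviation, Pi.sub_apply, sub_sub_sub_cancel_right, Finset.sum_sub_distrib]
    linarith
  rw [h1]
  congr 1
  refine Finset.sum_congr rfl fun i _ => ?_
  simp only [deviation, Pi.sub_apply]
  ring

theorem sum_smul_deviation_single {m : ℕ} {γ : Fin (m + 1) → ℝ} (hγ : ∑ i, γ i = 1) :
    ∑ i, γ i • deviation (Pi.single i 1) = deviation γ := by
  ext j
  simp [deviation, Finset.sum_apply, mul_sub, Finset.sum_sub_distrib, ← Finset.sum_mul, hγ,
    Pi.single_apply]

/-- The products are the entries of `v`, extended by a zero, minus their mean. Hence the deviations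
of the vertices form a frame whose frame operator is B⁻¹. -/
theorem sum_dotProduct_deviation_single_sq {m : ℕ} (v : Fin m → ℝ) :
    ∑ i, (v ⬝ᵥ deviation (Pi.single i 1)) ^ 2 = v ⬝ᵥ (brierMatrix m)⁻¹ *ᵥ v := by
  have hm : (m : ℝ) + 1 ≠ 0 := by positivity
  have h : ∀ i, v ⬝ᵥ deviation (Pi.single i 1) =
      ∑ j, v j * (if j.castSucc = i then 1 else 0) - (∑ j, v j) / ((m : ℝ) + 1) := by
    intro i
    simp [dotProduct, deviation, mul_sub, Finset.sum_sub_distrib, Pi.single_apply,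
      ← Finset.sum_mul, div_eq_mul_inv]
  have h1 : ∀ i : Fin m, ∑ j, v j * (if j.castSucc = i.castSucc then (1 : ℝ) else 0) = v i := by
    intro i
    simp
  have h2 : ∑ j : Fin m, v j * (if j.castSucc = Fin.last m then (1 : ℝ) else 0) = 0 :=
    Finset.sum_eq_zero fun j _ => by simp [(Fin.castSucc_lt_last j).ne]
  simp_rw [h]
  rw [Fin.sum_univ_castSucc]
  simp_rw [h1, h2]
  simp only [dotProduct, brierMatrix_inv_mulVec]
  set σ := ∑ j, v j with hσ
  have h3 : ∀ i, (v i - σ / ((m : ℝ) + 1)) ^ 2 = v i * (v i - σ / ((m : ℝ) + 1)) -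
      σ / ((m : ℝ) + 1) * v i + (σ / ((m : ℝ) + 1)) ^ 2 := fun i => by ring
  simp_rw [h3, Finset.sum_add_distrib, Finset.sum_sub_distrib, ← Finset.mul_sum, ← hσ]
  simp only [Finset.sum_const, Finset.card_univ, Fintype.card_fin, nsmul_eq_mul]
  generalize ∑ i, v i * (v i - σ / ((m : ℝ) + 1)) = τ
  field_simp
  ring

/-! ### Mixability of the Brier game. -/

section Schur

variable {m : ℕ} {W : Matrix (Fin m) (Fin m) ℝ}

/-- The inverse is antitone. -/
theorem posSemidef_brierMatrix_sub_inv (hW : W.PosDef)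
    (hBW : (W - (brierMatrix m)⁻¹).PosSemidef) : (brierMatrix m - W⁻¹).PosSemidef := by
  have hWd : IsUnit W.det := (isUnit_iff_isUnit_det _).1 hW.isUnit
  refine PosSemidef.of_dotProduct_mulVec_nonneg
    ((posDef_brierMatrix m).isHermitian.sub hW.inv.isHermitian) fun u => ?_
  -- Fenchel at W⁻¹u gives uᵀBu ≥ 2uᵀW⁻¹u - (W⁻¹u)ᵀB⁻¹(W⁻¹u), and W ≥ B⁻¹ bounds the subtracted term
  -- by uᵀW⁻¹u.
  have h1 := (posDef_brierMatrix m).two_mul_dotProduct_sub_le u (W⁻¹ *ᵥ u)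
  have h2 := hBW.dotProduct_mulVec_nonneg (W⁻¹ *ᵥ u)
  simp only [star_trivial, sub_mulVec, dotProduct_sub] at h2 ⊢
  rw [mulVec_mulVec u W, mul_nonsing_inv _ hWd, one_mulVec, dotProduct_comm _ u] at h2
  linarith

/-- With E = CᴴC the left side is a sum of variances, one for each row of C. The scalar variance
bound applies to each, and the frame identity turns the resulting sums of squares into the trace. -/
theorem sum_weighted_quadForm_deviation_le {γ : Fin (m + 1) → ℝ}
    (hγ : γ ∈ stdSimplex ℝ (Fin (m + 1))) {E : Matrix (Fin m) (Fin m) ℝ} (hE : E.PosSemidef) :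
    ∑ i, γ i * ((deviation (Pi.single i 1) - deviation γ) ⬝ᵥ
      E *ᵥ (deviation (Pi.single i 1) - deviation γ)) ≤
        1 / 2 * (E * (brierMatrix m)⁻¹).trace := by
  obtain ⟨C, rfl⟩ : ∃ C : Matrix (Fin m) (Fin m) ℝ, E = Cᴴ * C := by
    open scoped MatrixOrder in
    simpa [star_eq_conjTranspose] using
      (CStarAlgebra.nonneg_iff_eq_star_mul_self (a := E)).1 hE.nonneg
  have h1 : ∀ a : Fin m → ℝ, a ⬝ᵥ (Cᴴ * C) *ᵥ a = ∑ k, (C k ⬝ᵥ a) ^ 2 := by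
    intro a
    rw [← mulVec_mulVec, dotProduct_mulVec, ← mulVec_transpose]
    simp only [conjTranspose_eq_transpose_of_trivial, transpose_transpose]
    simp only [dotProduct, mulVec, sq]
  have h2 : ((Cᴴ * C) * (brierMatrix m)⁻¹).trace = ∑ k, C k ⬝ᵥ (brierMatrix m)⁻¹ *ᵥ C k := by
    rw [trace_mul_cycle, Matrix.mul_assoc, trace_mul_comm, Matrix.mul_assoc, trace_mul_comm,
      Matrix.mul_assoc]
    simp only [trace, diag_apply, mul_apply, dotProduct, mulVec, conjTranspose_apply, star_trivial]
  have h3 : ∀ (v : Fin m → ℝ) i, v ⬝ᵥ (deviation (Pi.single i 1) - deviation γ) =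
      v ⬝ᵥ deviation (Pi.single i 1) - ∑ j, γ j * (v ⬝ᵥ deviation (Pi.single j 1)) := by
    intro v i
    rw [dotProduct_sub, ← sum_smul_deviation_single hγ.2, dotProduct_sum]
    simp only [dotProduct_smul, smul_eq_mul]
  simp_rw [h2, h1, h3, ← sum_dotProduct_deviation_single_sq, Finset.mul_sum]
  rw [Finset.sum_comm]
  refine Finset.sum_le_sum fun k _ => ?_
  rw [← Finset.mul_sum]
  exact sum_weighted_sq_sub_mean_le γ hγ.1 hγ.2 _

/-- Mixability of the Brier game for Gaussian mixtures of experts, in dual form. -/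
theorem one_sub_sum_sq_le_sum_weighted (hW : W.PosDef)
    (hBW : (W - (brierMatrix m)⁻¹).PosSemidef) (μ : Fin m → ℝ) {γ : Fin (m + 1) → ℝ}
    (hγ : γ ∈ stdSimplex ℝ (Fin (m + 1))) :
    1 - ∑ i, γ i ^ 2 ≤
      ∑ i, γ i * ((deviation (Pi.single i 1) - μ) ⬝ᵥ W⁻¹ *ᵥ (deviation (Pi.single i 1) - μ) +
        1 / 2 * Real.log ((brierMatrix m).det * W.det)) := by
  have hB := posDef_brierMatrix m
  have hBd : IsUnit (brierMatrix m).det := (isUnit_iff_isUnit_det _).1 hB.isUnit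
  have h1 := sum_weighted_quadForm_sub W⁻¹ γ hγ.2 (fun i => deviation (Pi.single i 1))
    (deviation γ) μ (sum_smul_deviation_single hγ.2)
  have h2 := hW.inv.posSemidef.dotProduct_mulVec_nonneg (deviation γ - μ)
  rw [star_trivial] at h2
  have h3 := sum_weighted_quadForm_deviation_le hγ (posSemidef_brierMatrix_sub_inv hW hBW)
  have h4 := hB.card_sub_trace_le_log_det_mul hW
  simp only [sub_mulVec, dotProduct_sub _ (brierMatrix m *ᵥ _), mul_sub (γ _),
    Finset.sum_sub_distrib] at h3
  rw [Matrix.sub_mul, trace_sub, mul_nonsing_inv _ hBd, trace_one] at h3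
  have h5 : ∑ i, γ i * ((deviation (Pi.single i 1) - deviation γ) ⬝ᵥ
      brierMatrix m *ᵥ (deviation (Pi.single i 1) - deviation γ)) = 1 - ∑ i, γ i ^ 2 := by
    have : ∀ i, (deviation (Pi.single i 1) - deviation γ) ⬝ᵥ
        brierMatrix m *ᵥ (deviation (Pi.single i 1) - deviation γ) =
          1 - 2 * γ i + ∑ j, γ j ^ 2 := fun i => by
      rw [← brierLoss_eq_quadForm (by simp) hγ.2, brierLoss_single]
    have h' : ∀ i, γ i * (1 - 2 * γ i + ∑ j, γ j ^ 2) =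
        γ i - 2 * γ i ^ 2 + γ i * ∑ j, γ j ^ 2 := fun i => by ring
    simp_rw [this, h', Finset.sum_add_distrib, Finset.sum_sub_distrib, ← Finset.mul_sum,
      ← Finset.sum_mul, hγ.2]
    ring
  simp only [mul_add (γ _), Finset.sum_add_distrib, ← Finset.sum_mul, hγ.2]
  rw [h1]
  linarith

/-- A loss bound at the vertices of the simplex extends to the whole simplex, the difference of
the two sides being concave. -/
theorem brierLoss_le_of_single (hW : W.PosDef)
    (hBW : (W - (brierMatrix m)⁻¹).PosSemidef) (μ : Fin m → ℝ) (c : ℝ) {γ y : Fin (m + 1) → ℝ}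
    (hγ : ∑ i, γ i = 1) (hy : y ∈ stdSimplex ℝ (Fin (m + 1)))
    (h : ∀ i, brierLoss (Pi.single i 1) γ ≤
      (deviation (Pi.single i 1) - μ) ⬝ᵥ W⁻¹ *ᵥ (deviation (Pi.single i 1) - μ) + c) :
    brierLoss y γ ≤ (deviation y - μ) ⬝ᵥ W⁻¹ *ᵥ (deviation y - μ) + c := by
  have hmean := sum_smul_deviation_single hy.2
  have h1 := sum_weighted_quadForm_sub W⁻¹ y hy.2 _ _ μ hmean
  have h2 := sum_weighted_quadForm_sub (brierMatrix m) y hy.2 _ _ (deviation γ) hmean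
  have h3 : ∑ i, y i * brierLoss (Pi.single i 1) γ ≤
      ∑ i, y i * ((deviation (Pi.single i 1) - μ) ⬝ᵥ
        W⁻¹ *ᵥ (deviation (Pi.single i 1) - μ) + c) :=
    Finset.sum_le_sum fun i _ => mul_le_mul_of_nonneg_left (h i) (hy.1 i)
  have h4 : 0 ≤ ∑ i, y i * ((deviation (Pi.single i 1) - deviation y) ⬝ᵥ
      (brierMatrix m - W⁻¹) *ᵥ (deviation (Pi.single i 1) - deviation y)) :=
    Finset.sum_nonneg fun i _ => mul_nonneg (hy.1 i)
      ((posSemidef_brierMatrix_sub_inv hW hBW).dotProduct_mulVec_nonneg _)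
  have h5 : ∀ i, brierLoss (Pi.single i 1) γ = (deviation (Pi.single i 1) - deviation γ) ⬝ᵥ
      brierMatrix m *ᵥ (deviation (Pi.single i 1) - deviation γ) :=
    fun i => brierLoss_eq_quadForm (by simp) hγ
  simp only [mul_add (y _), Finset.sum_add_distrib, ← Finset.sum_mul, hy.2, h5] at h3
  simp only [sub_mulVec, dotProduct_sub _ (brierMatrix m *ᵥ _), mul_sub (y _),
    Finset.sum_sub_distrib] at h4
  rw [brierLoss_eq_quadForm hy.2 hγ]
  linarith

end Schur

/-! ### The substitution function. -/

section Substitution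

variable {m : ℕ}

theorem threshold_spec (r : Fin (m + 1) → ℝ) : ∑ i, max (threshold r - r i) 0 = 2 :=
  (existsUnique_threshold r).choose_spec.1

theorem substitution_mem_stdSimplex (r : Fin (m + 1) → ℝ) :
    substitution r ∈ stdSimplex ℝ (Fin (m + 1)) := by
  refine ⟨fun i => div_nonneg (le_max_right _ _) (by norm_num), ?_⟩
  simp only [substitution, ← Finset.sum_div, threshold_spec]
  norm_num

/-- The substitution function attains every generalized prediction that is consistent with
mixability in dual form. -/
theorem brierLoss_single_substitution_le (g r : Fin (m + 1) → ℝ) (c : ℝ)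
    (hr : ∀ i, r i = g i - c)
    (hg : ∀ γ ∈ stdSimplex ℝ (Fin (m + 1)), 1 - ∑ i, γ i ^ 2 ≤ ∑ i, γ i * g i)
    (i : Fin (m + 1)) : brierLoss (Pi.single i 1) (substitution r) ≤ g i := by
  set γ := substitution r with hγdef
  have hγ := substitution_mem_stdSimplex r
  rw [← hγdef] at hγ
  have h1 := hg γ hγ
  set s := threshold r
  -- Complementary slackness: 2γⱼ = s - rⱼ wherever γⱼ ≠ 0. Averaging over γ, the hypothesis at γ
  -- itself yields 1 + ∑ γⱼ² ≤ s + c.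
  have h2 : ∀ j, γ j * (s - r j) = 2 * γ j ^ 2 := by
    intro j
    simp only [γ, substitution]
    rcases le_total (threshold r - r j) 0 with h | h
    · rw [max_eq_right h]; ring
    · rw [max_eq_left h]; ring
  have h3 : ∑ j, γ j * g j = s + c - 2 * ∑ j, γ j ^ 2 := by
    have : ∀ j, γ j * g j = (s + c) * γ j - 2 * γ j ^ 2 := by
      intro j
      rw [← h2, hr]
      ring
    simp_rw [this, Finset.sum_sub_distrib, ← Finset.mul_sum, hγ.2]
    ring
  have h4 : s - r i ≤ 2 * γ i := by
    have := le_max_left (threshold r - r i) 0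
    simp only [γ, substitution, s]
    linarith
  have h5 := brierLoss_single i γ
  have := hr i
  linarith

end Substitution

/-! ### Ridge regression in dual form and its one-trial update. -/

open scoped Kronecker

/-- The regularized matrix of the dual ridge regression problem with Gram matrix `G`. -/
noncomputable def ridgeMatrix (m : ℕ) {n : ℕ} (G : Matrix (Fin n) (Fin n) ℝ) :
    Matrix (Fin m × Fin n) (Fin m × Fin n) ℝ :=
  (brierMatrix m)⁻¹ ⊗ₖ 1 + 1 ⊗ₖ G

/-- The deviations of all outcomes, stacked. -/
noncomputable def deviationVec {m n : ℕ} (y : Fin n → Fin (m + 1) → ℝ) : Fin m × Fin n → ℝ :=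
  fun p => deviation (y p.2) p.1

/-- The minimal regularized loss of the experts, in dual form. -/
noncomputable def ridgeLoss {m n : ℕ} (G : Matrix (Fin n) (Fin n) ℝ)
    (y : Fin n → Fin (m + 1) → ℝ) : ℝ :=
  deviationVec y ⬝ᵥ (ridgeMatrix m G)⁻¹ *ᵥ deviationVec y

/-- The Gram matrix of the kernel `k` at the points `x`. -/
def kernelGram {X : Type*} (k : X → X → ℝ) {n : ℕ} (x : Fin n → X) : Matrix (Fin n) (Fin n) ℝ :=
  Matrix.of fun s u => k (x s) (x u)

theorem posDef_ridgeMatrix (m : ℕ) {n : ℕ} {G : Matrix (Fin n) (Fin n) ℝ} (hG : G.PosSemidef) :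
    (ridgeMatrix m G).PosDef :=
  ((posDef_brierMatrix m).inv.kronecker PosDef.one).add_posSemidef
    (PosSemidef.one.kronecker hG)

theorem blockGram_one {X : Type*} (k : X → X → ℝ) (m : ℕ) {n : ℕ} (x : Fin n → X) :
    blockGram k 1 m x = 1 + brierMatrix m ⊗ₖ kernelGram k x := by
  ext p q
  simp only [blockGram, one_smul, Matrix.add_apply, Matrix.of_apply, kroneckerMap_apply,
    brierMatrix, kernelGram]
  congr 2
  rw [Matrix.one_apply]
  split_ifs <;> norm_num

/-- Connects the matrix inverted by the algorithm with that of the dual problem; their determinants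
differ by one factor det B per trial. -/
theorem blockGram_eq_mul_ridgeMatrix {X : Type*} (k : X → X → ℝ) (m : ℕ) {n : ℕ} (x : Fin n → X) :
    blockGram k 1 m x = (brierMatrix m ⊗ₖ 1) * ridgeMatrix m (kernelGram k x) := by
  have hBd : IsUnit (brierMatrix m).det :=
    (isUnit_iff_isUnit_det _).1 (posDef_brierMatrix m).isUnit
  rw [blockGram_one, ridgeMatrix, Matrix.mul_add, ← mul_kronecker_mul, ← mul_kronecker_mul,
    mul_nonsing_inv _ hBd, Matrix.mul_one, Matrix.mul_one, Matrix.one_mul, one_kronecker_one]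

theorem posDef_blockGram_one {X : Type*} {k : X → X → ℝ} (m : ℕ) {n : ℕ} {x : Fin n → X}
    (hk : (kernelGram k x).PosSemidef) : (blockGram k 1 m x).PosDef := by
  rw [blockGram_one]
  exact PosDef.one.add_posSemidef ((posDef_brierMatrix m).posSemidef.kronecker hk)

theorem det_blockGram_one {X : Type*} (k : X → X → ℝ) (m : ℕ) {n : ℕ} (x : Fin n → X) :
    (blockGram k 1 m x).det =
      (brierMatrix m).det ^ n * (ridgeMatrix m (kernelGram k x)).det := by
  rw [blockGram_eq_mul_ridgeMatrix, det_mul, det_kronecker]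
  simp

/-- Splitting off the last trial of each block. -/
def blockSnocEquiv (m n : ℕ) : (Fin m × Fin n) ⊕ Fin m ≃ Fin m × Fin (n + 1) where
  toFun := Sum.elim (fun p => (p.1, p.2.castSucc)) (fun i => (i, Fin.last n))
  invFun p := Fin.lastCases (motive := fun _ => (Fin m × Fin n) ⊕ Fin m)
    (Sum.inr p.1) (fun s => Sum.inl (p.1, s)) p.2
  left_inv p := by rcases p with p | i <;> simp
  right_inv p := by
    rcases p with ⟨i, s⟩
    induction s using Fin.lastCases <;> simp

/-- The effect of one more trial on the minimal regularized loss and on the determinant. -/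
theorem exists_ridgeLoss_snoc {X : Type*} {k : X → X → ℝ} (m : ℕ) {t : ℕ} {x : Fin (t + 1) → X}
    (hk : (kernelGram k x).PosSemidef) :
    ∃ W : Matrix (Fin m) (Fin m) ℝ, W.PosDef ∧ (W - (brierMatrix m)⁻¹).PosSemidef ∧
      (blockGram k 1 m x).det =
        (blockGram k 1 m (fun s : Fin t => x s.castSucc)).det * ((brierMatrix m).det * W.det) ∧
      ∀ y : Fin t → Fin (m + 1) → ℝ, ∃ μ : Fin m → ℝ, ∀ y₀ : Fin (m + 1) → ℝ,
        ridgeLoss (kernelGram k x) (Fin.snoc (α := fun _ => Fin (m + 1) → ℝ) y y₀) =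
          ridgeLoss (kernelGram k (fun s : Fin t => x s.castSucc)) y +
            (deviation y₀ - μ) ⬝ᵥ W⁻¹ *ᵥ (deviation y₀ - μ) := by
  set G := kernelGram k x with hGdef
  set G' := kernelGram k (fun s : Fin t => x s.castSucc) with hG'def
  have hG' : G'.PosSemidef := hk.submatrix Fin.castSucc
  have hGsymm : ∀ s u, G s u = G u s := fun s u => (hk.isHermitian.apply s u).symm
  set e := blockSnocEquiv m t
  set P := ridgeMatrix m G'
  have hP : P.PosDef := posDef_ridgeMatrix m hG'
  set Q : Matrix (Fin m × Fin t) (Fin m) ℝ :=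
    Matrix.of fun p j => if p.1 = j then G p.2.castSucc (Fin.last t) else 0
  set N : Matrix (Fin m) (Fin m) ℝ := G (Fin.last t) (Fin.last t) • 1
  have h1G : (1 ⊗ₖ G : Matrix (Fin m × Fin (t + 1)) _ ℝ).submatrix e e =
      fromBlocks (1 ⊗ₖ G') Q Qᵀ N := by
    ext p q
    rcases p with p | i <;> rcases q with q | j
    · rfl
    · simp [e, blockSnocEquiv, Q, Matrix.one_apply]
    · simp [e, blockSnocEquiv, Q, Matrix.one_apply, hGsymm (Fin.last t), eq_comm]
    · simp [e, blockSnocEquiv, N, Matrix.one_apply]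
  have hB1 : ((brierMatrix m)⁻¹ ⊗ₖ 1 : Matrix (Fin m × Fin (t + 1)) _ ℝ).submatrix e e =
      fromBlocks ((brierMatrix m)⁻¹ ⊗ₖ 1) 0 0 (brierMatrix m)⁻¹ := by
    ext p q
    rcases p with p | i <;> rcases q with q | j
    · simp [e, blockSnocEquiv, Matrix.one_apply]
    · simp [e, blockSnocEquiv, (Fin.castSucc_lt_last _).ne]
    · simp [e, blockSnocEquiv, (Fin.castSucc_lt_last _).ne']
    · simp [e, blockSnocEquiv]
  have hD : (ridgeMatrix m G).submatrix e e = fromBlocks P Q Qᵀ ((brierMatrix m)⁻¹ + N) := by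
    have : (ridgeMatrix m G).submatrix e e =
        ((brierMatrix m)⁻¹ ⊗ₖ 1 : Matrix (Fin m × Fin (t + 1)) _ ℝ).submatrix e e +
          (1 ⊗ₖ G : Matrix (Fin m × Fin (t + 1)) _ ℝ).submatrix e e := rfl
    rw [this, h1G, hB1, fromBlocks_add, zero_add, zero_add]
    rfl
  -- The corner omits its summand B⁻¹, so that the Schur complement here is W - B⁻¹ and its
  -- positivity gives W ≥ B⁻¹.
  have hPN : (fromBlocks P Q Qᵀ N).PosSemidef := by
    have h1 : (fromBlocks (1 ⊗ₖ G') Q Qᵀ N).PosSemidef := by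
      rw [← h1G]
      exact (PosSemidef.one.kronecker hk).submatrix e
    have h2 : (fromBlocks ((brierMatrix m)⁻¹ ⊗ₖ (1 : Matrix (Fin t) (Fin t) ℝ)) 0 0
        (0 : Matrix (Fin m) (Fin m) ℝ)).PosSemidef := by
      have hX := (posDef_brierMatrix m).inv.kronecker (PosDef.one (n := Fin t) (R := ℝ))
      let := hX.isUnit.invertible
      have := (hX.fromBlocks₁₁ (0 : Matrix (Fin m × Fin t) (Fin m) ℝ) 0).2
        (by simpa using PosSemidef.zero)
      simpa using this
    have h3 := h2.add h1
    rw [fromBlocks_add, zero_add, zero_add, zero_add] at h3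
    exact h3
  have hS : (N - Qᵀ * P⁻¹ * Q).PosSemidef := by
    let := hP.isUnit.invertible
    have := (hP.fromBlocks₁₁ Q N).1 (by simpa using hPN)
    simpa using this
  set W := (brierMatrix m)⁻¹ + N - Qᵀ * P⁻¹ * Q with hWdef
  have hWB : W - (brierMatrix m)⁻¹ = N - Qᵀ * P⁻¹ * Q := by rw [hWdef]; abel
  have hW : W.PosDef := by
    rw [hWdef, add_sub_assoc]
    exact (posDef_brierMatrix m).inv.add_posSemidef hS
  -- The centre μ is the kernel ridge prediction of the new deviation from the past ones.
  refine ⟨W, hW, hWB ▸ hS, ?_, fun y => ⟨Qᵀ *ᵥ P⁻¹ *ᵥ deviationVec y, fun y₀ => ?_⟩⟩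
  · rw [det_blockGram_one, det_blockGram_one, ← det_submatrix_equiv_self e (ridgeMatrix m _), hD]
    let := hP.isUnit.invertible
    rw [det_fromBlocks₁₁, invOf_eq_nonsing_inv]
    ring
  · have hz : (deviationVec (Fin.snoc (α := fun _ => Fin (m + 1) → ℝ) y y₀)) ∘ e =
        Sum.elim (deviationVec y) (deviation y₀) := by
      ext p
      rcases p with p | i <;> simp [e, blockSnocEquiv, deviationVec]
    have h := dotProduct_inv_fromBlocks hP Q ((brierMatrix m)⁻¹ + N) hW (deviationVec y)
      (deviation y₀)
    rw [← hD, ← hz, inv_submatrix_equiv, submatrix_mulVec_equiv] at h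
    rw [ridgeLoss, ridgeLoss, ← h]
    simp only [Function.comp_assoc, Equiv.self_comp_symm, Function.comp_id]
    exact (comp_equiv_dotProduct_comp_equiv _ _ e).symm

/-! ### The scores as differences of dual values. -/

section Score

variable {X : Type*} {m : ℕ}

theorem brierMatrix_kronecker_one_mulVec {n : ℕ} (v : Fin m × Fin n → ℝ) (p : Fin m × Fin n) :
    ((brierMatrix m ⊗ₖ (1 : Matrix (Fin n) (Fin n) ℝ)) *ᵥ v) p =
      (brierMatrix m *ᵥ fun i => v (i, p.2)) p.1 := by
  simp [mulVec, dotProduct, Fintype.sum_prod_type, Matrix.one_apply]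

/-- The scores of mKAAR are differences of minimal regularized losses. -/
theorem mkaarScore_eq_ridgeLoss_sub {k : X → X → ℝ} {t : ℕ} {x : Fin (t + 1) → X}
    (hk : (kernelGram k x).PosSemidef) {y : Fin t → Fin (m + 1) → ℝ}
    (hy : ∀ s, ∑ i, y s i = 1) (i : Fin (m + 1)) :
    mkaarScore k 1 x y i =
      ridgeLoss (kernelGram k x) (Fin.snoc (α := fun _ => Fin (m + 1) → ℝ) y (Pi.single i 1)) -
        ridgeLoss (kernelGram k x)
          (Fin.snoc (α := fun _ => Fin (m + 1) → ℝ) y (Pi.single (Fin.last m) 1)) := by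
  induction i using Fin.lastCases with
  | last => simp [mkaarScore]
  | cast i =>
  set A := blockGram k 1 m x with hA
  have hApd : A.PosDef := posDef_blockGram_one m hk
  have hAd : IsUnit A.det := (isUnit_iff_isUnit_det _).1 hApd.isUnit
  have hAT : (A⁻¹)ᵀ = A⁻¹ := hApd.inv.isHermitian
  set D := ridgeMatrix m (kernelGram k x)
  have hDT : (D⁻¹)ᵀ = D⁻¹ := (posDef_ridgeMatrix m hk).inv.isHermitian
  set E : Fin m × Fin (t + 1) → ℝ := Pi.single (i, Fin.last t) 1 with hE
  set z : Fin (m + 1) → Fin m × Fin (t + 1) → ℝ := fun j =>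
    deviationVec (Fin.snoc (α := fun _ => Fin (m + 1) → ℝ) y (Pi.single j 1)) with hz
  set b : Fin (m + 1) → Fin m × Fin (t + 1) → ℝ := fun j =>
    (brierMatrix m ⊗ₖ 1) *ᵥ z j with hb
  -- The kernel vector of the algorithm is AE - E for the unit vector E at component i of the
  -- current trial, so A⁻¹ maps it to E - A⁻¹E.
  have hAE : A *ᵥ E = E + fun p => (if p.1 = i then 2 else 1) * k (x p.2) (x (Fin.last t)) := by
    rw [hA, blockGram, one_smul, add_mulVec, one_mulVec]
    congr 1
    ext p
    simp [hE]
  have hAE' : A⁻¹ *ᵥ (fun p => (if p.1 = i then 2 else 1) * k (x p.2) (x (Fin.last t))) =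
      E - A⁻¹ *ᵥ E := by
    have h : (fun p : Fin m × Fin (t + 1) =>
        (if p.1 = i then (2 : ℝ) else 1) * k (x p.2) (x (Fin.last t))) = A *ᵥ E - E := by
      rw [hAE, add_sub_cancel_left]
    rw [h, mulVec_sub, mulVec_mulVec, nonsing_inv_mul _ hAd, one_mulVec]
  have hbE : ∀ j, b j ⬝ᵥ A⁻¹ *ᵥ E = z j ⬝ᵥ D⁻¹ *ᵥ E := by
    intro j
    have hBu : IsUnit (brierMatrix m ⊗ₖ (1 : Matrix (Fin (t + 1)) (Fin (t + 1)) ℝ)).det :=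
      (isUnit_iff_isUnit_det _).1 ((posDef_brierMatrix m).kronecker PosDef.one).isUnit
    rw [dotProduct_mulVec, dotProduct_mulVec, ← mulVec_transpose, ← mulVec_transpose, hAT, hDT,
      hA, blockGram_eq_mul_ridgeMatrix, Matrix.mul_inv_rev, hb]
    simp only [mulVec_mulVec]
    rw [Matrix.mul_assoc, nonsing_inv_mul _ hBu, Matrix.mul_one]
  have hbval : ∀ j p, b j p =
      (Fin.snoc (α := fun _ => Fin (m + 1) → ℝ) y (Pi.single j 1) p.2) p.1.castSucc -
        (Fin.snoc (α := fun _ => Fin (m + 1) → ℝ) y (Pi.single j 1) p.2) (Fin.last m) := by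
    rintro j ⟨l, s⟩
    simp only [hb]
    rw [brierMatrix_kronecker_one_mulVec]
    have hsum : ∑ i, Fin.snoc (α := fun _ => Fin (m + 1) → ℝ) y (Pi.single j 1) s i = 1 := by
      induction s using Fin.lastCases with
      | last => simp
      | cast s => simpa using hy s
    exact brierMatrix_mulVec_deviation hsum l
  -- At the current trial, `b i.castSucc + b (Fin.last m)` has entry 0 in block i and -1 in the
  -- others. This accounts for the constants 0 and -1/2 in the outcome vectors.
  have hv : (fun p : Fin m × Fin (t + 1) =>
      outcomeVec y (if p.1 = i then 0 else -1 / 2) p.1 p.2) =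
        -(b i.castSucc + b (Fin.last m)) := by
    ext ⟨l, s⟩
    simp only [Pi.neg_apply, Pi.add_apply, hbval, outcomeVec]
    induction s using Fin.lastCases with
    | last =>
      simp only [Fin.snoc_last, Pi.single_apply, Fin.castSucc_inj, (Fin.castSucc_lt_last _).ne,
        (Fin.castSucc_lt_last _).ne', if_true, if_false]
      split_ifs <;> norm_num
    | cast s =>
      simp only [Fin.snoc_castSucc]
      ring
  have hvE : (b i.castSucc + b (Fin.last m)) ⬝ᵥ E = 0 := by
    rw [hE, dotProduct_single, Pi.add_apply, hbval, hbval]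
    simp [(Fin.castSucc_lt_last _).ne, (Fin.castSucc_lt_last _).ne']
  -- The difference of the two dual values therefore factors as (zᵢ + z_d)ᵀD⁻¹E.
  have hzE : z i.castSucc - z (Fin.last m) = E := by
    ext ⟨l, s⟩
    simp only [hz, hE, Pi.sub_apply, deviationVec, deviation]
    induction s using Fin.lastCases with
    | last => simp [Pi.single_apply, (Fin.castSucc_lt_last _).ne]
    | cast s => simp [(Fin.castSucc_lt_last _).ne]
  have hcomm : z (Fin.last m) ⬝ᵥ D⁻¹ *ᵥ z i.castSucc = z i.castSucc ⬝ᵥ D⁻¹ *ᵥ z (Fin.last m) := by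
    rw [dotProduct_mulVec, ← mulVec_transpose, hDT, dotProduct_comm]
  have hscore : mkaarScore k 1 x y i.castSucc =
      (-(b i.castSucc + b (Fin.last m))) ⬝ᵥ (E - A⁻¹ *ᵥ E) := by
    rw [← hAE', ← hv]
    simp [mkaarScore, hA]
  rw [hscore, neg_dotProduct, dotProduct_sub, hvE, add_dotProduct, hbE, hbE, ← hzE]
  simp only [mulVec_sub, dotProduct_sub, hcomm, ridgeLoss]
  simp only [hz, D]
  ring

theorem blockGram_eq_smul (K : X → X → ℝ) {a : ℝ} (ha : a ≠ 0) {n : ℕ} (x : Fin n → X) :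
    blockGram K a m x = a • blockGram (fun u v => K u v / a) 1 m x := by
  ext p q
  simp only [blockGram, Matrix.add_apply, Matrix.smul_apply, Matrix.of_apply, smul_eq_mul]
  field_simp

/-- The factor a⁻¹ of the inverse matrix is absorbed by the kernel vector. -/
theorem mkaarScore_eq_div (K : X → X → ℝ) {a : ℝ} (ha : a ≠ 0) {t : ℕ} {x : Fin (t + 1) → X}
    (hK : (kernelGram (fun u v => K u v / a) x).PosSemidef) (y : Fin t → Fin (m + 1) → ℝ) :
    mkaarScore K a x y = mkaarScore (fun u v => K u v / a) 1 x y := by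
  have hinv : (blockGram K a m x)⁻¹ = a⁻¹ • (blockGram (fun u v => K u v / a) 1 m x)⁻¹ := by
    rw [blockGram_eq_smul K ha, ← Units.smul_mk0 ha, Matrix.inv_smul' _ _
      ((isUnit_iff_isUnit_det _).1 (posDef_blockGram_one m hK).isUnit)]
    rfl
  simp only [mkaarScore, hinv, smul_mulVec, ← mulVec_smul]
  congr 1
  ext i
  congr 2
  ext p
  simp only [Pi.smul_apply, smul_eq_mul]
  ring

end Score

/-! ### Induction over the trials. -/

section Regret

variable {X : Type*} {m : ℕ}

/-- The loss of mKAAR is at most the minimal regularized loss plus the log-determinant term, for a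
positive semidefinite kernel. -/
theorem mkaarLoss_one_le {k : X → X → ℝ} (x : ℕ → X)
    (hk : ∀ n, (kernelGram k fun s : Fin n => x s).PosSemidef)
    (y : ℕ → Fin (m + 1) → ℝ) (T : ℕ) (hy : ∀ t < T, y t ∈ stdSimplex ℝ (Fin (m + 1))) :
    mkaarLoss k 1 x y T ≤
      ridgeLoss (kernelGram k fun s : Fin T => x s) (fun s : Fin T => y s) +
        1 / 2 * Real.log (blockGram k 1 m fun s : Fin T => x s).det := by
  induction T with
  | zero => simp [mkaarLoss, ridgeLoss, dotProduct]
  | succ t ih =>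
    have ih := ih fun s hs => hy s (by omega)
    have hyt := hy t (by omega)
    obtain ⟨W, hW, hBW, hdet, hloss⟩ := exists_ridgeLoss_snoc m (hk (t + 1))
    obtain ⟨μ, hμ⟩ := hloss fun s : Fin t => y s
    simp only [Fin.val_castSucc] at hdet hμ
    have hsnoc : (fun s : Fin (t + 1) => y s) =
        Fin.snoc (α := fun _ => Fin (m + 1) → ℝ) (fun s : Fin t => y s) (y t) := by
      ext1 s
      induction s using Fin.lastCases <;> simp
    have hBdet := (posDef_brierMatrix m).det_pos
    have hlog := Real.log_mul (posDef_blockGram_one m (hk t)).det_pos.ne'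
      (mul_pos hBdet hW.det_pos).ne'
    have hstep : brierLoss (y t)
        (mkaarPredict k 1 (fun s : Fin (t + 1) => x s) (fun s : Fin t => y s)) ≤
          (deviation (y t) - μ) ⬝ᵥ W⁻¹ *ᵥ (deviation (y t) - μ) +
            1 / 2 * Real.log ((brierMatrix m).det * W.det) := by
      refine brierLoss_le_of_single hW hBW μ _ (substitution_mem_stdSimplex _).2 hyt ?_
      -- The common shift is the bound at the last vertex, whose score is 0; the dual value of the
      -- past cancels in the difference.
      refine brierLoss_single_substitution_le _ _
        ((deviation (Pi.single (Fin.last m) 1) - μ) ⬝ᵥ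
          W⁻¹ *ᵥ (deviation (Pi.single (Fin.last m) 1) - μ) +
            1 / 2 * Real.log ((brierMatrix m).det * W.det)) (fun i => ?_)
        (fun γ hγ => one_sub_sum_sq_le_sum_weighted hW hBW μ hγ)
      rw [mkaarScore_eq_ridgeLoss_sub (hk (t + 1)) (fun s => (hy s (by omega)).2), hμ, hμ]
      ring
    rw [hsnoc, hμ, hdet, hlog, mkaarLoss, Finset.sum_range_succ]
    rw [mkaarLoss] at ih
    linarith

end Regret

/-! ### The reproducing kernel Hilbert space and weak duality. -/

section RKHS

variable {X : Type*} {F : Type*} [NormedAddCommGroup F] [InnerProductSpace ℝ F]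
    [CompleteSpace F] [RKHS ℝ F X ℝ]

theorem scalarKernel_eq_inner (x y : X) :
    scalarKernel F x y = inner ℝ (RKHS.kerFun F x (1 : ℝ)) (RKHS.kerFun F y (1 : ℝ)) := by
  rw [RKHS.kerFun_inner, RKHS.kerFun_apply]
  simp [scalarKernel]

theorem posSemidef_kernelGram_scalarKernel_div {a : ℝ} (ha : 0 < a) {n : ℕ} (x : Fin n → X) :
    (kernelGram (fun u v => scalarKernel F u v / a) x).PosSemidef := by
  have h := (posSemidef_gram ℝ fun s => RKHS.kerFun F (x s) (1 : ℝ)).smul (inv_pos.2 ha).le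
  have hgram : kernelGram (fun u v => scalarKernel F u v / a) x =
      a⁻¹ • gram ℝ fun s => RKHS.kerFun F (x s) (1 : ℝ) := by
    ext s u
    simp only [kernelGram, Matrix.of_apply, scalarKernel_eq_inner, Matrix.smul_apply, smul_eq_mul,
      gram_apply]
    ring
  rw [hgram]
  exact h

/-- The Fenchel inequality for the regularizer: expand ‖a f - g‖² ≥ 0, where g is the combination of
kernel sections with coefficients `c`, and divide by a. -/
theorem two_mul_sum_sub_le_mul_norm_sq {a : ℝ} (ha : 0 < a) {n : ℕ} (x : Fin n → X)
    (c : Fin n → ℝ) (f : F) :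
    2 * (∑ s, c s * f (x s)) -
      c ⬝ᵥ kernelGram (fun u v => scalarKernel F u v / a) x *ᵥ c ≤ a * ‖f‖ ^ 2 := by
  set g : F := ∑ s, c s • RKHS.kerFun F (x s) (1 : ℝ) with hg
  have hfg : inner ℝ f g = ∑ s, c s * f (x s) := by
    simp [hg, inner_sum, inner_smul_right]
  have hgg : c ⬝ᵥ kernelGram (fun u v => scalarKernel F u v / a) x *ᵥ c = ‖g‖ ^ 2 / a := by
    rw [← real_inner_self_eq_norm_sq, hg]
    simp only [sum_inner, inner_sum, inner_smul_left, inner_smul_right, dotProduct, mulVec,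
      kernelGram, Matrix.of_apply, ← scalarKernel_eq_inner, Finset.mul_sum, Finset.sum_div]
    refine Finset.sum_congr rfl fun s _ => Finset.sum_congr rfl fun u _ => ?_
    have hsymm : scalarKernel F (x u) (x s) = scalarKernel F (x s) (x u) := by
      rw [scalarKernel_eq_inner, scalarKernel_eq_inner, real_inner_comm]
    simp only [conj_trivial, hsymm]
    ring
  have h : 0 ≤ ‖a • f - g‖ ^ 2 := sq_nonneg _
  rw [norm_sub_sq_real, norm_smul, inner_smul_left, hfg, conj_trivial, Real.norm_eq_abs, mul_pow,
    sq_abs] at h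
  rw [hgg]
  have h2 : a * ‖f‖ ^ 2 - (2 * (∑ s, c s * f (x s)) - ‖g‖ ^ 2 / a) =
      (a ^ 2 * ‖f‖ ^ 2 - 2 * (a * ∑ s, c s * f (x s)) + ‖g‖ ^ 2) / a := by
    generalize ∑ s, c s * f (x s) = τ
    field_simp
    ring
  have h3 := div_nonneg h ha.le
  linarith

/-- The dual value bounds the regularized loss of every expert from below. -/
theorem ridgeLoss_le_expert {m : ℕ} {a : ℝ} (ha : 0 < a) (f : Fin m → F) {n : ℕ} (x : Fin n → X)
    (y : Fin n → Fin (m + 1) → ℝ) (hy : ∀ s, ∑ i, y s i = 1) :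
    ridgeLoss (kernelGram (fun u v => scalarKernel F u v / a) x) y ≤
      ∑ s, brierLoss (y s) (expertPredict (fun i => ⇑(f i)) (x s)) + a * ∑ i, ‖f i‖ ^ 2 := by
  set G := kernelGram (fun u v => scalarKernel F u v / a) x
  have hD := posDef_ridgeMatrix m
    (posSemidef_kernelGram_scalarKernel_div (F := F) ha x : G.PosSemidef)
  have hDd : IsUnit (ridgeMatrix m G).det := (isUnit_iff_isUnit_det _).1 hD.isUnit
  set z := deviationVec y with hz
  -- The optimal dual variable. The dual value is 2zᵀα - αᵀDα; Fenchel is applied to each trial's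
  -- loss and each component's norm, and the terms α f(x) cancel in the sum.
  set α := (ridgeMatrix m G)⁻¹ *ᵥ z with hα
  have hDα : ridgeMatrix m G *ᵥ α = z := by
    rw [hα, mulVec_mulVec, mul_nonsing_inv _ hDd, one_mulVec]
  have hquad : z ⬝ᵥ α =
      ∑ s, (fun i => α (i, s)) ⬝ᵥ (brierMatrix m)⁻¹ *ᵥ (fun i => α (i, s)) +
        ∑ i, (fun s => α (i, s)) ⬝ᵥ G *ᵥ (fun s => α (i, s)) := by
    rw [← hDα, dotProduct_comm, ridgeMatrix, add_mulVec, dotProduct_add]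
    congr 1
    · simp only [dotProduct, mulVec, Fintype.sum_prod_type, kroneckerMap_apply, Matrix.one_apply]
      rw [Finset.sum_comm]
      simp
    · simp only [dotProduct, mulVec, Fintype.sum_prod_type, kroneckerMap_apply, Matrix.one_apply]
      simp
  have hlin : z ⬝ᵥ α = ∑ s, deviation (y s) ⬝ᵥ (fun i => α (i, s)) := by
    simp only [dotProduct, Fintype.sum_prod_type, hz, deviationVec]
    rw [Finset.sum_comm]
  have hloss : ∀ s, 2 * (deviation (y s) ⬝ᵥ fun i => α (i, s)) - 2 * ∑ i, α (i, s) * f i (x s) -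
      (fun i => α (i, s)) ⬝ᵥ (brierMatrix m)⁻¹ *ᵥ (fun i => α (i, s)) ≤
        brierLoss (y s) (expertPredict (fun i => ⇑(f i)) (x s)) := by
    intro s
    have hdev : deviation (expertPredict (fun i => ⇑(f i)) (x s)) = fun i => f i (x s) := by
      ext i
      simp [deviation, expertPredict]
    have hsum : ∑ j, expertPredict (fun i => ⇑(f i)) (x s) j = 1 := by
      rw [Fin.sum_univ_castSucc]
      simp only [expertPredict, Fin.snoc_castSucc, Fin.snoc_last]
      ring
    rw [brierLoss_eq_quadForm (hy s) hsum, hdev]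
    have h := (posDef_brierMatrix m).two_mul_dotProduct_sub_le
      (deviation (y s) - fun i => f i (x s)) (fun i => α (i, s))
    rw [sub_dotProduct] at h
    have h' : (fun i => f i (x s)) ⬝ᵥ (fun i => α (i, s)) = ∑ i, α (i, s) * f i (x s) :=
      Finset.sum_congr rfl fun i _ => mul_comm _ _
    linarith
  have hnorm := Finset.sum_le_sum fun (i : Fin m) (_ : i ∈ Finset.univ) =>
    two_mul_sum_sub_le_mul_norm_sq ha x (fun s => α (i, s)) (f i)
  have hloss' := Finset.sum_le_sum fun (s : Fin n) (_ : s ∈ Finset.univ) => hloss s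
  simp only [Finset.sum_sub_distrib, ← Finset.mul_sum] at hnorm hloss'
  rw [Finset.sum_comm (f := fun s i => α (i, s) * f i (x s))] at hloss'
  rw [ridgeLoss, ← hα]
  linarith

end RKHS

/-! ### The loss bound. -/

theorem theorem4 {X : Type*} {F : Type*} [NormedAddCommGroup F] [InnerProductSpace ℝ F]
    [CompleteSpace F] [RKHS ℝ F X ℝ] (m : ℕ) (a : ℝ) (ha : 0 < a) (f : Fin m → F)
    (T : ℕ) (hT : 0 < T) (x : ℕ → X) (y : ℕ → Fin (m + 1) → ℝ)
    (hy : ∀ t < T, y t ∈ stdSimplex ℝ (Fin (m + 1))) :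
    mkaarLoss (scalarKernel F) a x y T ≤
      expertLoss (fun i => ⇑(f i)) x y T + a * ∑ i, ‖f i‖ ^ 2 +
        1 / 2 * Real.log
          (a⁻¹ • blockGram (scalarKernel F) a m (fun s : Fin T => x s)).det := by
  have h1 := mkaarLoss_one_le x
    (fun n => posSemidef_kernelGram_scalarKernel_div (F := F) ha fun s : Fin n => x s) y T hy
  have h2 := ridgeLoss_le_expert ha f (fun s : Fin T => x s) (fun s : Fin T => y s)
    fun s => (hy s s.2).2
  have h3 : expertLoss (fun i => ⇑(f i)) x y T =
      ∑ s : Fin T, brierLoss (y s) (expertPredict (fun i => ⇑(f i)) (x s)) :=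
    (Fin.sum_univ_eq_sum_range
      (fun t => brierLoss (y t) (expertPredict (fun i => ⇑(f i)) (x t))) T).symm
  have h4 : mkaarLoss (scalarKernel F) a x y T =
      mkaarLoss (fun u v => scalarKernel F u v / a) 1 x y T := by
    simp only [mkaarLoss, mkaarPredict, mkaarScore_eq_div _ ha.ne'
      (posSemidef_kernelGram_scalarKernel_div (F := F) ha _)]
  rw [h3, h4, blockGram_eq_smul _ ha.ne', smul_smul, inv_mul_cancel₀ ha.ne', one_smul]
  linarith
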